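/- Let $\mathbb{F}$ be an algebraically closed field, and write $\mathbb{A}^n=\mathbb{F}^n$ with the Zariski topology. An affine variety in $\mathbb{A}^n$ is the set of common zeros of a set of polynomials in $\mathbb{F}[X_1,\dots,X_n]$ (not necessarily irreducible). Let $m\le n$, $k,\ell$ be nonnegative integers and $\epsilon\in\mathbb{R}$. A family of polynomial maps $\varphi_1,\dots,\varphi_\ell:\mathbb{A}^n\to\mathbb{A}^m$ is called an $(n,m,k,\epsilon)$ seeded rank extractor for varieties (resp. for subspaces) if for every affine variety (resp. linear subspace) $V\subseteq\mathbb{A}^n$ over $\mathbb{F}$ of dimension at least $k$, at most $\epsilon\ell$ of the indices $i\in\{1,\dots,\ell\}$ fail to satisfy $\dim\overline{\varphi_i(V)}=m$. It is called linear if every $\varphi_i$ is a linear map, i.e. is defined by homogeneous linear polynomials. 1. Every $(n,m,k,\epsilon)$ linear seeded rank extractor for subspaces is also an $(n,m,k,\epsilon)$ linear seeded rank extractor for varieties. 2. For every polynomial map $\varphi:\mathbb{A}^n\to\mathbb{A}^m$ and every affine variety $V\subseteq\mathbb{A}^n$, the condition $\dim\overline{\varphi(V)}=m$ is equivalent to $\varphi|_V:V\to\mathbb{A}^m$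 being dominant, i.e. $\overline{\varphi(V)}=\mathbb{A}^m$. So in 1, for every affine variety $V\subseteq\mathbb{A}^n$ of dimension at least $k$, all but at most an $\epsilon$ fraction of the maps $\varphi_i|_V:V\to\mathbb{A}^m$ are dominant. 3. Let $1\le m\le n$, let $\omega\in\mathbb{F}^\times$ have multiplicative order at least $n$ (possibly infinite), and let $s_1,\dots,s_\ell\in\mathbb{F}^\times$ be distinct. For $i\in\{1,\dots,\ell\}$ let $\varphi_i:\mathbb{A}^n\to\mathbb{A}^m$ be the linear map given by the $m\times n$ matrix $\bigl((\omega^{j'-1}s_i)^{j-1}\bigr)_{1\le j'\le m,\,1\le j\le n}$. Then $(\varphi_i)_{1\le i\le\ell}$ is a linear $(n,m,m,\epsilon)$ seeded rank extractor for varieties, where $\epsilon=m(n-m)/\ell$. -/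

import Mathlib

/-! Affine `n`-space over an algebraically closed field `F` is `Fin n → F`. -/

namespace RankExtractor

noncomputable section

/-- An affine variety in `𝔸ⁿ`: the set of common zeros of a set of polynomials
(not necessarily irreducible, possibly empty). -/
def IsAffineVariety {F : Type*} [Field F] {n : ℕ} (V : Set (Fin n → F)) : Prop :=
  ∃ S : Set (MvPolynomial (Fin n) F), V = {x | ∀ f ∈ S, MvPolynomial.eval x f = 0}

/-- An irreducible affine variety: nonempty and not the union of two proper subvarieties. -/
def IsIrreducibleVariety {F : Type*} [Field F] {n : ℕ} (V : Set (Fin n → F)) : Prop :=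
  IsAffineVariety V ∧ V.Nonempty ∧
    ∀ Z₁ Z₂ : Set (Fin n → F), IsAffineVariety Z₁ → IsAffineVariety Z₂ →
      V = Z₁ ∪ Z₂ → V = Z₁ ∨ V = Z₂

/-- The dimension of an affine variety `V`: the supremum of the lengths `d` of chains
`V₀ ⊊ V₁ ⊊ ⋯ ⊊ V_d` of irreducible affine subvarieties of `V`. It is `⊥` for `V = ∅`. -/
def dimension {F : Type*} [Field F] {n : ℕ} (V : Set (Fin n → F)) : WithBot ℕ∞ :=
  Order.krullDim {Z : Set (Fin n → F) // IsIrreducibleVariety Z ∧ Z ⊆ V}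

/-- The Zariski closure: the intersection of all affine varieties containing `S`. -/
def zariskiClosure {F : Type*} [Field F] {n : ℕ} (S : Set (Fin n → F)) : Set (Fin n → F) :=
  ⋂₀ {Z | IsAffineVariety Z ∧ S ⊆ Z}

/-- A polynomial map `𝔸ⁿ → 𝔸ᵐ`, given by the `m` polynomials that define it. -/
abbrev PolyMap (F : Type*) [Field F] (n m : ℕ) : Type _ :=
  Fin m → MvPolynomial (Fin n) F

/-- The map on points. -/
def PolyMap.toFun {F : Type*} [Field F] {n m : ℕ} (φ : PolyMap F n m)
    (x : Fin n → F) : Fin m → F :=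
  fun i => MvPolynomial.eval x (φ i)

/-- A polynomial map is linear if it is defined by (homogeneous) linear polynomials. -/
def PolyMap.IsLinear {F : Type*} [Field F] {n m : ℕ} (φ : PolyMap F n m) : Prop :=
  ∀ i, (φ i).IsHomogeneous 1

/-- The restriction `φ|_V : V → 𝔸ᵐ` is dominant. -/
def IsDominantOn {F : Type*} [Field F] {n m : ℕ} (φ : PolyMap F n m)
    (V : Set (Fin n → F)) : Prop :=
  zariskiClosure (φ.toFun '' V) = Set.univ

/-- `φ` has full rank on `V`: the closure of `φ(V)` has dimension `m`. -/
def HasFullRankOn {F : Type*} [Field F] {n m : ℕ} (φ : PolyMap F n m)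
    (V : Set (Fin n → F)) : Prop :=
  dimension (zariskiClosure (φ.toFun '' V)) = (m : WithBot ℕ∞)

/-- `(n, m, k, ε)` seeded rank extractors for varieties: for every affine variety of dimension
at least `k`, at most an `ε` fraction of the `ℓ` maps fail to have full rank on it. -/
def IsSeededRankExtractorForVarieties {F : Type*} [Field F] (n m k : ℕ) (ε : ℝ) {ℓ : ℕ}
    (φ : Fin ℓ → PolyMap F n m) : Prop :=
  m ≤ n ∧ ∀ V : Set (Fin n → F), IsAffineVariety V → (k : WithBot ℕ∞) ≤ dimension V →
    (({i : Fin ℓ | ¬ HasFullRankOn (φ i) V}.ncard : ℕ) : ℝ) ≤ ε * (ℓ : ℝ)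

/-- `(n, m, k, ε)` seeded rank extractors for linear subspaces. -/
def IsSeededRankExtractorForSubspaces {F : Type*} [Field F] (n m k : ℕ) (ε : ℝ) {ℓ : ℕ}
    (φ : Fin ℓ → PolyMap F n m) : Prop :=
  m ≤ n ∧ ∀ V : Submodule F (Fin n → F), k ≤ Module.finrank F V →
    (({i : Fin ℓ | ¬ HasFullRankOn (φ i) (V : Set (Fin n → F))}.ncard : ℕ) : ℝ) ≤ ε * (ℓ : ℝ)

/-- Linear seeded rank extractors for varieties. -/
def IsLinearSeededRankExtractorForVarieties {F : Type*} [Field F] (n m k : ℕ) (ε : ℝ) {ℓ : ℕ}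
    (φ : Fin ℓ → PolyMap F n m) : Prop :=
  (∀ i, (φ i).IsLinear) ∧ IsSeededRankExtractorForVarieties n m k ε φ

/-- Linear seeded rank extractors for subspaces. -/
def IsLinearSeededRankExtractorForSubspaces {F : Type*} [Field F] (n m k : ℕ) (ε : ℝ) {ℓ : ℕ}
    (φ : Fin ℓ → PolyMap F n m) : Prop :=
  (∀ i, (φ i).IsLinear) ∧ IsSeededRankExtractorForSubspaces n m k ε φ

/-- The Forbes–Shpilka map with parameters `ω` and `s`: the linear map of the `m × n` matrix
with entries `(ω ^ j' * s) ^ j`, the indices `j' < m`, `j < n` starting from `0`. -/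
def forbesShpilkaMap {F : Type*} [Field F] (n m : ℕ) (ω s : Fˣ) : PolyMap F n m :=
  fun j' => ∑ j : Fin n,
    MvPolynomial.C (((ω : F) ^ (j' : ℕ) * (s : F)) ^ (j : ℕ)) * MvPolynomial.X j

end

end RankExtractor

/-!
Let `V` have dimension at least `k` and pick an irreducible `Z ⊆ V` of dimension at least `k`. The
tangent space of `Z` at its generic point has dimension at least `k`; specializing a frame of it at
a rational point gives a subspace `W` with `k ≤ dim W`. A linear map `A` that is onto on `W` is onto
on the generic tangent space: derivations into the function field of `Z` take arbitrary values on
the coordinates of `A x`, so an algebraic relation of minimal degree among these coordinates has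
vanishing partial derivatives. In characteristic zero this is absurd. In characteristic `p` the
relation is a polynomial in `p`-th powers, and applying to its coefficients a map that is linear
over the inverse of Frobenius gives a relation of smaller degree: the new relation holds at every
rational point, and these are dense.

For the Forbes–Shpilka maps, take an echelon family in a subspace of dimension at least `m`. The
determinant of the map on this family is a polynomial in the seed, nonzero because its top
coefficient is a nonzero multiple of a Vandermonde determinant in distinct powers of `ω`. Its
exponents are sums of `m` distinct indices below `n`, so they lie in a window of width `m (n - m)`,
and the polynomial has at most that many nonzero roots.
-/

namespace RankExtractor

open MvPolynomial

noncomputable section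

section ZariskiTopology

variable {F : Type*} [Field F] {n : ℕ}

theorem isAffineVariety_zeroLocus (I : Ideal (MvPolynomial (Fin n) F)) :
    IsAffineVariety (zeroLocus F I) :=
  ⟨I, by ext; simp [mem_zeroLocus_iff]⟩

theorem IsAffineVariety.zeroLocus_vanishingIdeal {V : Set (Fin n → F)} (hV : IsAffineVariety V) :
    zeroLocus F (vanishingIdeal F V) = V := by
  obtain ⟨S, rfl⟩ := hV
  refine Set.Subset.antisymm (fun x hx f hf => ?_) (zeroLocus_vanishingIdeal_le _)
  simpa using hx f (fun y hy => by simpa using hy f hf)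

theorem IsAffineVariety.inter_zeros {V : Set (Fin n → F)} (hV : IsAffineVariety V)
    (f : MvPolynomial (Fin n) F) : IsAffineVariety (V ∩ {x | eval x f = 0}) := by
  obtain ⟨S, rfl⟩ := hV
  exact ⟨insert f S, by ext; simp [and_comm]⟩

theorem zariskiClosure_eq_zeroLocus (S : Set (Fin n → F)) :
    zariskiClosure S = zeroLocus F (vanishingIdeal F S) := by
  refine Set.Subset.antisymm
    (fun x hx => hx _ ⟨isAffineVariety_zeroLocus _, zeroLocus_vanishingIdeal_le S⟩) ?_
  rintro x hx Z ⟨hZ, hSZ⟩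
  rw [← hZ.zeroLocus_vanishingIdeal]
  exact zeroLocus_anti_mono (vanishingIdeal_anti_mono hSZ) hx

theorem isAffineVariety_zariskiClosure (S : Set (Fin n → F)) :
    IsAffineVariety (zariskiClosure S) :=
  zariskiClosure_eq_zeroLocus S ▸ isAffineVariety_zeroLocus _

theorem IsAffineVariety.zariskiClosure_eq {V : Set (Fin n → F)} (hV : IsAffineVariety V) :
    zariskiClosure V = V := by
  rw [zariskiClosure_eq_zeroLocus, hV.zeroLocus_vanishingIdeal]

theorem vanishingIdeal_univ [Infinite F] :
    vanishingIdeal F (Set.univ : Set (Fin n → F)) = ⊥ :=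
  (Submodule.eq_bot_iff _).mpr fun _ hf =>
    MvPolynomial.funext fun x => by simpa using hf x (Set.mem_univ x)

theorem zariskiClosure_eq_univ_iff [Infinite F] {S : Set (Fin n → F)} :
    zariskiClosure S = Set.univ ↔ vanishingIdeal F S = ⊥ := by
  rw [zariskiClosure_eq_zeroLocus]
  refine ⟨fun h => ?_, fun h => h ▸ zeroLocus_bot⟩
  rw [← le_bot_iff, ← vanishingIdeal_univ, ← h]
  exact le_vanishingIdeal_zeroLocus _

theorem isIrreducibleVariety_iff {Z : Set (Fin n → F)} :
    IsIrreducibleVariety Z ↔ IsAffineVariety Z ∧ (vanishingIdeal F Z).IsPrime := by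
  constructor
  · rintro ⟨hZ, ⟨z, hz⟩, hirr⟩
    refine ⟨hZ, ⟨fun h => ?_, fun {f g} hfg => ?_⟩⟩
    · simpa using h.ge (Submodule.mem_top (x := 1)) z hz
    · have hcover : Z = Z ∩ {x | eval x f = 0} ∪ Z ∩ {x | eval x g = 0} := by
        rw [← Set.inter_union_distrib_left, eq_comm, Set.inter_eq_left]
        intro x hx
        simpa using hfg x hx
      refine (hirr _ _ (hZ.inter_zeros f) (hZ.inter_zeros g) hcover).imp ?_ ?_ <;>
        exact fun h x hx => by simpa using (h.le hx).2
  · rintro ⟨hZ, hprime⟩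
    refine ⟨hZ, Set.nonempty_iff_ne_empty.mpr ?_, fun Z₁ Z₂ h₁ h₂ h => ?_⟩
    · rintro rfl
      exact hprime.ne_top vanishingIdeal_empty
    have hmul : vanishingIdeal F Z₁ * vanishingIdeal F Z₂ ≤ vanishingIdeal F Z := by
      rw [Ideal.mul_le, h]
      rintro f hf g hg x (hx | hx)
      · rw [map_mul, hf x hx, zero_mul]
      · rw [map_mul, hg x hx, mul_zero]
    have hsub {Y : Set (Fin n → F)} (hY : IsAffineVariety Y)
        (hle : vanishingIdeal F Y ≤ vanishingIdeal F Z) : Z ⊆ Y := by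
      rw [← hY.zeroLocus_vanishingIdeal, ← hZ.zeroLocus_vanishingIdeal]
      exact zeroLocus_anti_mono hle
    exact (hprime.mul_le.mp hmul).imp
      (fun hle => (hsub h₁ hle).antisymm (h ▸ Set.subset_union_left))
      (fun hle => (hsub h₂ hle).antisymm (h ▸ Set.subset_union_right))

theorem IsIrreducibleVariety.isPrime_vanishingIdeal {Z : Set (Fin n → F)}
    (hZ : IsIrreducibleVariety Z) : (vanishingIdeal F Z).IsPrime :=
  (isIrreducibleVariety_iff.mp hZ).2

theorem dimension_le_ringKrullDim (V : Set (Fin n → F)) :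
    dimension V ≤ ringKrullDim (MvPolynomial (Fin n) F ⧸ vanishingIdeal F V) := by
  rw [ringKrullDim_quotient, ← Order.krullDim_orderDual]
  refine Order.krullDim_le_of_strictMono (fun Z => OrderDual.toDual
    ⟨⟨vanishingIdeal F Z.1, Z.2.1.isPrime_vanishingIdeal⟩, vanishingIdeal_anti_mono Z.2.2⟩)
    fun Z₁ Z₂ h => ?_
  refine lt_of_le_of_ne (vanishingIdeal_anti_mono h.le) fun heq => h.ne (Subtype.ext ?_)
  rw [← Z₁.2.1.1.zeroLocus_vanishingIdeal, ← Z₂.2.1.1.zeroLocus_vanishingIdeal]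
  have := congrArg (fun P => (OrderDual.ofDual P).1.asIdeal) heq
  exact congrArg (zeroLocus F) this

theorem exists_irreducible_le_dimension {V : Set (Fin n → F)} {k : ℕ}
    (h : (k : WithBot ℕ∞) ≤ dimension V) :
    ∃ Z, IsIrreducibleVariety Z ∧ Z ⊆ V ∧ (k : WithBot ℕ∞) ≤ dimension Z := by
  obtain ⟨l, rfl⟩ := Order.le_krullDim_iff.mp h
  refine ⟨l.last.1, l.last.2.1, l.last.2.2, Order.le_krullDim_iff.mpr ⟨LTSeries.mk l.length
    (fun i => ⟨(l i).1, (l i).2.1, l.strictMono.monotone (Fin.le_last i)⟩) fun i j hij => ?_, rfl⟩⟩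
  exact l.strictMono hij

end ZariskiTopology

section PolynomialMaps

variable {F : Type*} [Field F] {n m : ℕ}

theorem vanishingIdeal_image_toFun (φ : PolyMap F n m) (V : Set (Fin n → F)) :
    vanishingIdeal F (φ.toFun '' V) = (vanishingIdeal F V).comap (aeval φ) := by
  have hcomp (x : Fin n → F) : aeval (φ.toFun x) = (aeval (R := F) x).comp (aeval φ) := by
    ext; simp [PolyMap.toFun, aeval_eq_eval]
  ext f
  simp only [mem_vanishingIdeal_iff, Set.forall_mem_image, hcomp, AlgHom.comp_apply,
    Ideal.mem_comap]

theorem isDominantOn_iff_algebraicIndependent [Infinite F] {φ : PolyMap F n m}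
    {V : Set (Fin n → F)} :
    IsDominantOn φ V ↔
      AlgebraicIndependent F fun i => Ideal.Quotient.mk (vanishingIdeal F V) (φ i) := by
  have haeval : aeval (fun i => Ideal.Quotient.mk (vanishingIdeal F V) (φ i)) =
      (Ideal.Quotient.mkₐ F (vanishingIdeal F V)).comp (aeval φ) := by
    ext; simp
  rw [IsDominantOn, zariskiClosure_eq_univ_iff, vanishingIdeal_image_toFun,
    algebraicIndependent_iff_ker_eq_bot, haeval]
  change _ ↔ RingHom.ker ((Ideal.Quotient.mk (vanishingIdeal F V)).comp (aeval φ).toRingHom) = ⊥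
  rw [← RingHom.comap_ker, Ideal.mk_ker]
  rfl

theorem IsDominantOn.mono {φ : PolyMap F n m} {V V' : Set (Fin n → F)} (h : IsDominantOn φ V)
    (hV : V ⊆ V') : IsDominantOn φ V' :=
  Set.eq_univ_of_univ_subset fun x _ Z hZ =>
    Set.mem_sInter.mp (h.ge (Set.mem_univ x)) Z ⟨hZ.1, (Set.image_mono hV).trans hZ.2⟩

theorem toFun_toMvPolynomial (A : Matrix (Fin m) (Fin n) F) (x : Fin n → F) :
    PolyMap.toFun A.toMvPolynomial x = A.mulVec x :=
  funext fun i => A.toMvPolynomial_eval_eq_apply i x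

theorem PolyMap.IsLinear.exists_eq_toMvPolynomial {φ : PolyMap F n m} (hφ : φ.IsLinear) :
    ∃ A : Matrix (Fin m) (Fin n) F, φ = A.toMvPolynomial := by
  refine ⟨.of fun i j => coeff (Finsupp.single j 1) (φ i), ?_⟩
  ext i d
  simp only [Matrix.toMvPolynomial, Matrix.of_apply, coeff_sum, coeff_monomial]
  by_cases hd : d.degree = 1
  · obtain ⟨j, rfl⟩ := (Finsupp.sum_eq_one_iff d).mp hd
    simp [Finsupp.single_left_inj]
  · rw [(hφ i).coeff_eq_zero hd]
    refine (Finset.sum_eq_zero fun j _ => if_neg ?_).symm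
    rintro rfl
    simp at hd

end PolynomialMaps

section Subspaces

variable {F : Type*} [Field F] {n m : ℕ}

theorem exists_matrix_mem_iff_mulVec_eq (W : Submodule F (Fin n → F)) :
    ∃ P : Matrix (Fin n) (Fin n) F, LinearMap.range P.mulVecLin = W ∧
      ∀ x, x ∈ W ↔ P.mulVec x = x := by
  obtain ⟨r, hr⟩ := W.subtype.exists_leftInverse_of_injective W.ker_subtype
  have hr' (w : W) : r w = w := LinearMap.congr_fun hr w
  have hmul (x : Fin n → F) : (LinearMap.toMatrix' (W.subtype ∘ₗ r)).mulVec x = r x := by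
    rw [← Matrix.toLin'_apply, Matrix.toLin'_toMatrix']
    rfl
  have hmem (x : Fin n → F) : x ∈ W ↔ (r x : Fin n → F) = x :=
    ⟨fun hx => congrArg Subtype.val (hr' ⟨x, hx⟩), fun hx => hx ▸ (r x).2⟩
  refine ⟨LinearMap.toMatrix' (W.subtype ∘ₗ r), ?_, fun x => by rw [hmul, hmem]⟩
  ext x
  simp only [LinearMap.mem_range, Matrix.mulVecLin_apply, hmul]
  exact ⟨fun ⟨y, hy⟩ => hy ▸ (r y).2, fun hx => ⟨x, (hmem x).mp hx⟩⟩

theorem isAffineVariety_submodule (W : Submodule F (Fin n → F)) :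
    IsAffineVariety (W : Set (Fin n → F)) := by
  obtain ⟨P, -, hP⟩ := exists_matrix_mem_iff_mulVec_eq W
  refine ⟨Set.range fun i => P.toMvPolynomial i - X i, ?_⟩
  ext x
  simp [hP, funext_iff, Matrix.toMvPolynomial_eval_eq_apply, sub_eq_zero]

theorem isIrreducibleVariety_submodule [Infinite F] (W : Submodule F (Fin n → F)) :
    IsIrreducibleVariety (W : Set (Fin n → F)) := by
  obtain ⟨P, hP, -⟩ := exists_matrix_mem_iff_mulVec_eq W
  have himage : (W : Set (Fin n → F)) = PolyMap.toFun P.toMvPolynomial '' Set.univ := by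
    rw [← hP, funext (toFun_toMvPolynomial P), Set.image_univ]
    rfl
  refine isIrreducibleVariety_iff.mpr ⟨isAffineVariety_submodule W, ?_⟩
  rw [himage, vanishingIdeal_image_toFun, vanishingIdeal_univ]
  exact Ideal.isPrime_bot.comap _

theorem isDominantOn_toMvPolynomial_iff {A : Matrix (Fin m) (Fin n) F}
    {W : Submodule F (Fin n → F)} :
    IsDominantOn A.toMvPolynomial (W : Set (Fin n → F)) ↔ W.map A.mulVecLin = ⊤ := by
  have himage : PolyMap.toFun A.toMvPolynomial '' (W : Set (Fin n → F)) = W.map A.mulVecLin := by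
    ext; simp [toFun_toMvPolynomial]
  rw [IsDominantOn, himage, (isAffineVariety_submodule _).zariskiClosure_eq,
    ← Submodule.top_coe (R := F), SetLike.coe_set_eq]

end Subspaces

section FullRank

variable {F : Type*} [Field F] [Infinite F] {n m : ℕ}

theorem dimension_univ : dimension (Set.univ : Set (Fin n → F)) = n := by
  refine le_antisymm ?_ ?_
  · refine (dimension_le_ringKrullDim _).trans ((ringKrullDim_quotient_le _).trans ?_)
    simp
  · calc (n : WithBot ℕ∞) = Module.length F (Fin n → F) := by simp [Module.length_eq_finrank]
      _ = Order.krullDim (Submodule F (Fin n → F)) := Module.coe_length F _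
      _ ≤ dimension Set.univ := Order.krullDim_le_of_strictMono
          (fun W => ⟨W, isIrreducibleVariety_submodule W, Set.subset_univ _⟩) fun _ _ h => h

theorem IsAffineVariety.dimension_eq_iff {V : Set (Fin n → F)} (hV : IsAffineVariety V) :
    dimension V = n ↔ V = Set.univ := by
  refine ⟨fun h => ?_, fun h => h ▸ dimension_univ⟩
  by_contra hne
  have hI : vanishingIdeal F V ≠ ⊥ := by
    rwa [Ne, ← zariskiClosure_eq_univ_iff, hV.zariskiClosure_eq]
  obtain ⟨f, hf, hf0⟩ := Submodule.exists_mem_ne_zero_of_ne_bot hI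
  have hlt := ringKrullDim_succ_le_of_surjective _ Ideal.Quotient.mk_surjective
    (mem_nonZeroDivisors_of_ne_zero hf0) (Ideal.Quotient.eq_zero_iff_mem.mpr hf)
  have hle : ((n + 1 : ℕ) : WithBot ℕ∞) ≤ (n : ℕ) := by
    calc ((n + 1 : ℕ) : WithBot ℕ∞) = dimension V + 1 := by rw [h]; rfl
      _ ≤ ringKrullDim (MvPolynomial (Fin n) F ⧸ vanishingIdeal F V) + 1 := by
        gcongr
        exact dimension_le_ringKrullDim V
      _ ≤ _ := hlt
      _ = n := by simp
  exact absurd (Nat.cast_le.mp hle) (by simp)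

theorem hasFullRankOn_iff_isDominantOn {φ : PolyMap F n m} {V : Set (Fin n → F)} :
    HasFullRankOn φ V ↔ IsDominantOn φ V :=
  (isAffineVariety_zariskiClosure _).dimension_eq_iff

end FullRank

section PDerivations

variable {R σ : Type*} [CommRing R]

theorem exists_expand_eq_of_pderiv_eq_zero [NoZeroDivisors R] (p : ℕ) [CharP R p]
    {f : MvPolynomial σ R} (hf : ∀ i, pderiv i f = 0) : ∃ g, expand p g = f := by
  have hdvd {d : σ →₀ ℕ} (hd : d ∈ f.support) (i : σ) : p ∣ d i := by
    rcases Nat.eq_zero_or_pos (d i) with h0 | hpos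
    · simp [h0]
    · have hle : Finsupp.single i 1 ≤ d := Finsupp.single_le_iff.mpr hpos
      have hcoeff := coeff_pderiv (i := i) f (d - Finsupp.single i 1)
      rw [hf, coeff_zero, tsub_add_cancel_of_le hle, eq_comm, ← Nat.cast_add_one] at hcoeff
      have := (mul_eq_zero.mp hcoeff).resolve_left (mem_support_iff.mp hd)
      rwa [CharP.cast_eq_zero_iff R p, Finsupp.tsub_apply, Finsupp.single_eq_same,
        Nat.sub_add_cancel hpos] at this
  refine ⟨∑ d ∈ f.support, monomial (d.mapRange (· / p) (Nat.zero_div p)) (coeff d f), ?_⟩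
  conv_rhs => rw [f.as_sum]
  rw [map_sum]
  refine Finset.sum_congr rfl fun d hd => ?_
  rw [expand_monomial]
  congr
  ext i
  simp [Nat.mul_div_cancel' (hdvd hd i)]

theorem totalDegree_pderiv_lt {f : MvPolynomial σ R} (hf : f.totalDegree ≠ 0) (i : σ) :
    (pderiv i f).totalDegree < f.totalDegree := by
  refine (Finset.sup_lt_iff (Nat.pos_of_ne_zero hf)).mpr fun d hd => ?_
  have hd' : d + Finsupp.single i 1 ∈ f.support := by
    rw [mem_support_iff, coeff_pderiv] at hd
    exact mem_support_iff.mpr (left_ne_zero_of_mul hd)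
  have hle := le_totalDegree hd'
  rw [Finsupp.sum_add_index' (by simp) (by simp), Finsupp.sum_single_index rfl] at hle
  lia

theorem algebraMap_aeval_pderiv {S L : Type*} [CommRing S] [Algebra R S] [CommRing L]
    [Algebra R L] [Algebra S L] [IsScalarTower R S L] [DecidableEq σ] {y : σ → S} {i : σ}
    {δ : Derivation R S L} (hδ : ∀ j, δ (y j) = (Pi.single i 1 : σ → L) j) (f : MvPolynomial σ R) :
    algebraMap S L (aeval y (pderiv i f)) = δ (aeval y f) := by
  induction f using MvPolynomial.induction_on with
  | C a => simp
  | add f g hf hg => simp [hf, hg]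
  | mul_X f j hf =>
    rw [pderiv_mul, map_add, map_mul, map_mul, map_add, map_mul, hf, map_mul (aeval y), δ.leibniz,
      aeval_X, hδ, pderiv_X, Algebra.smul_def, Algebra.smul_def]
    rcases eq_or_ne j i with rfl | hj
    · simp [mul_comm, add_comm]
    · simp [hj, mul_comm]

end PDerivations

section InverseFrobenius

variable {k : Type*} [Field k] {p : ℕ} [Fact p.Prime] [CharP k p]

/-- `μ` is linear with respect to the inverse of the Frobenius endomorphism; over a perfect field
these are the multiples of that inverse. -/
def IsFrobeniusInverseLinear {R : Type*} [CommSemiring R] (p : ℕ) (μ : R →+ R) : Prop :=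
  ∀ a b, μ (a ^ p * b) = a * μ b

theorem exists_isFrobeniusInverseLinear_ne_zero {c : k} (hc : c ≠ 0) :
    ∃ μ : k →+ k, IsFrobeniusInverseLinear p μ ∧ μ c ≠ 0 := by
  obtain ⟨l, hl⟩ := Module.Projective.exists_dual_ne_zero (frobenius k p).fieldRange hc
  let e := (frobenius k p).rangeRestrictFieldEquiv
  refine ⟨(e.symm : _ →+ k).comp l.toAddMonoidHom, fun a b => ?_, by simpa using hl⟩
  have ha : a ^ p * b = e a • b := rfl
  simp [ha]

theorem IsFrobeniusInverseLinear.eval_map {R σ : Type*} [CommRing R] {p : ℕ} {μ : R →+ R}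
    (hμ : IsFrobeniusInverseLinear p μ) (z : σ → R) (g : MvPolynomial σ R) :
    eval z (AddMonoidAlgebra.map μ g : MvPolynomial σ R) = μ (eval z (expand p g)) := by
  induction g using MvPolynomial.induction_on' with
  | monomial d c =>
    have hprod : (d.prod fun i e => (z ^ p) i ^ e) = (d.prod fun i e => z i ^ e) ^ p := by
      simp only [Finsupp.prod, ← Finset.prod_pow, Pi.pow_apply, ← pow_mul, mul_comm]
    calc eval z (AddMonoidAlgebra.map μ (monomial d c))
        = eval z (monomial d (μ c)) := congrArg _ (AddMonoidAlgebra.map_single μ c d)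
      _ = (d.prod fun i e => z i ^ e) * μ c := by rw [eval_monomial, mul_comm]
      _ = μ ((d.prod fun i e => z i ^ e) ^ p * c) := (hμ _ _).symm
      _ = μ (eval z (expand p (monomial d c))) := by
        rw [eval_expand, eval_monomial, hprod, mul_comm]
  | add f g hf hg =>
    rw [map_add (expand p), map_add (eval z), map_add μ, ← hf, ← hg, ← map_add]
    exact congrArg _ (AddMonoidAlgebra.map_add μ f g)

end InverseFrobenius

section RationalPoints

/-- The `k`-rational points of `R` are dense: every nonzero element of `R` is nonzero at some of
them. -/
def HasDenseRationalPoints (k R : Type*) [CommRing k] [CommRing R] [Algebra k R] : Prop :=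
  ∀ r : R, r ≠ 0 → ∃ ev : R →ₐ[k] k, ev r ≠ 0

theorem HasDenseRationalPoints.eq_zero_of_aeval_expand {k R σ : Type*} [Field k] [CommRing R]
    [Algebra k R] (hR : HasDenseRationalPoints k R) {p : ℕ} [Fact p.Prime] [CharP k p] {y : σ → R}
    {g : MvPolynomial σ k} (hg : aeval y (expand p g) = 0)
    (hdeg : ∀ h : MvPolynomial σ k, h.totalDegree ≤ g.totalDegree → aeval y h = 0 → h = 0) :
    g = 0 := by
  by_contra hne
  obtain ⟨d, hd⟩ := ne_zero_iff.mp hne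
  obtain ⟨μ, hμ, hμd⟩ := exists_isFrobeniusInverseLinear_ne_zero (p := p) hd
  let h : MvPolynomial σ k := AddMonoidAlgebra.map μ g
  have hcoeff (e : σ →₀ ℕ) : coeff e h = μ (coeff e g) := rfl
  have hroot : aeval y h = 0 := by
    by_contra h0
    obtain ⟨ev, hev⟩ := hR _ h0
    refine hev ?_
    have heval (f : MvPolynomial σ k) : ev (aeval y f) = eval (fun i => ev (y i)) f := by
      rw [← aeval_eq_eval, ← comp_aeval_apply]
    rw [heval, hμ.eval_map, ← heval, hg, map_zero, map_zero]
  have hsupport : h.support ⊆ g.support := fun e he => by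
    rw [mem_support_iff, hcoeff] at he
    exact mem_support_iff.mpr fun h0 => he (by rw [h0, map_zero])
  have hzero := hdeg h (Finset.sup_mono hsupport) hroot
  exact hμd (by rw [← hcoeff, hzero, coeff_zero])

theorem HasDenseRationalPoints.algebraicIndependent {k R L ι : Type*} [Field k] [CommRing R]
    [Algebra k R] (hR : HasDenseRationalPoints k R) [Field L] [Algebra k L] [Algebra R L]
    [IsScalarTower k R L] [FaithfulSMul R L] {y : ι → R}
    (hy : ∀ w : ι → L, ∃ δ : Derivation k R L, ∀ i, δ (y i) = w i) :
    AlgebraicIndependent k y := by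
  classical
  have : Nontrivial R := (algebraMap R L).domain_nontrivial
  rw [algebraicIndependent_iff]
  intro f
  induction hN : f.totalDegree using Nat.strong_induction_on generalizing f with
  | _ N ih =>
  intro hf
  subst hN
  have hconst (h0 : f.totalDegree = 0) : f = 0 := by
    rw [totalDegree_eq_zero_iff_eq_C.mp h0] at hf ⊢
    simpa using hf
  by_cases h0 : f.totalDegree = 0
  · exact hconst h0
  have hpderiv (i : ι) : pderiv i f = 0 := by
    obtain ⟨δ, hδ⟩ := hy (Pi.single i 1)
    refine ih _ (totalDegree_pderiv_lt h0 i) _ rfl (FaithfulSMul.algebraMap_injective R L ?_)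
    rw [algebraMap_aeval_pderiv hδ, hf, map_zero, map_zero]
  obtain ⟨p, hp⟩ := CharP.exists k
  obtain ⟨g, rfl⟩ := exists_expand_eq_of_pderiv_eq_zero p hpderiv
  rw [totalDegree_expand] at h0 ih
  have : Fact p.Prime := ⟨(CharP.char_is_prime_or_zero k p).resolve_right (right_ne_zero_of_mul h0)⟩
  rw [hR.eq_zero_of_aeval_expand hf fun h hh => ih _ ?_ h rfl, map_zero]
  refine hh.trans_lt ?_
  exact lt_mul_of_one_lt_right (Nat.pos_of_ne_zero (left_ne_zero_of_mul h0)) this.out.one_lt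

end RationalPoints

section TangentSpace

/- A differential basis `s` makes `K` unramified, hence separable algebraic, over `k(s)`. Equality
fails in general over an imperfect `k`. -/
theorem trdeg_le_rank_kaehlerDifferential (k K : Type*) [Field k] [Field K] [Algebra k K]
    [Algebra.EssFiniteType k K] : Algebra.trdeg k K ≤ Module.rank K Ω[K⁄k] := by
  obtain ⟨b, hb, hspan, hli⟩ :=
    exists_linearIndependent K (Set.range (KaehlerDifferential.D k K))
  rw [KaehlerDifferential.span_range_derivation] at hspan
  obtain ⟨s, -, hs⟩ := Set.SurjOn.exists_bijOn_subset (s := Set.univ)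
    (f := KaehlerDifferential.D k K) (t := b) (by rwa [Set.SurjOn, Set.image_univ])
  let E := IntermediateField.adjoin k s
  have hzero : KaehlerDifferential.map k E K K = 0 := by
    refine LinearMap.ext_on hspan fun v hv => ?_
    obtain ⟨a, ha, rfl⟩ := hs.surjOn hv
    rw [KaehlerDifferential.map_D]
    exact (KaehlerDifferential.D E K).map_algebraMap ⟨a, IntermediateField.subset_adjoin k s ha⟩
  have : Subsingleton Ω[K⁄E] := by
    refine subsingleton_of_forall_eq 0 fun v => ?_
    obtain ⟨u, rfl⟩ := KaehlerDifferential.map_surjective k E K v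
    rw [hzero, LinearMap.zero_apply]
  have : Algebra.FormallyUnramified E K := ⟨this⟩
  have : Algebra.EssFiniteType E K := .of_comp k E K
  have : Algebra.IsSeparable E K := Algebra.FormallyUnramified.isSeparable E K
  have : Algebra.IsAlgebraic (Algebra.adjoin k s) K :=
    IntermediateField.isAlgebraic_adjoin_iff_top.mp inferInstance
  calc Algebra.trdeg k K ≤ Cardinal.mk s := Algebra.IsAlgebraic.trdeg_le_cardinalMk k s
    _ = Cardinal.mk b := Cardinal.mk_congr (hs.equiv _)
    _ ≤ Module.rank K Ω[K⁄k] := hli.cardinal_le_rank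

theorem natCast_le_trdeg_of_le_ringKrullDim (k R K : Type*) [Field k] [CommRing R] [IsDomain R]
    [Algebra k R] [Algebra.FiniteType k R] [Field K] [Algebra k K] [Algebra R K]
    [IsScalarTower k R K] [FaithfulSMul R K] {d : ℕ} (h : (d : WithBot ℕ∞) ≤ ringKrullDim R) :
    (d : Cardinal) ≤ Algebra.trdeg k K := by
  obtain ⟨s, g, hinj, hg⟩ := exists_integral_inj_algHom_of_fg k R
  have hds : d ≤ s := by
    algebraize [g.toRingHom]
    have hle : ringKrullDim R ≤ ringKrullDim (MvPolynomial (Fin s) k) :=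
      Order.krullDim_le_of_strictMono (PrimeSpectrum.comap (algebraMap _ R)) fun P Q hPQ =>
        Ideal.IsIntegral.comap_lt_comap (I := P.asIdeal) hPQ
    rw [MvPolynomial.ringKrullDim_of_isNoetherianRing, ringKrullDim_eq_zero_of_field,
      zero_add, Nat.card_fin] at hle
    exact Nat.cast_le.mp (h.trans hle)
  have hcomp : Function.Injective ((IsScalarTower.toAlgHom k R K).comp g) :=
    (FaithfulSMul.algebraMap_injective R K).comp hinj
  have := ((algebraicIndependent_X (Fin s) k).map' hcomp).lift_cardinalMk_le_trdeg
  rw [Cardinal.mk_fin, Cardinal.lift_natCast, Cardinal.lift_id'] at this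
  exact (Nat.cast_le.mpr hds).trans this

variable {k R ι : Type*} [CommRing k] [CommRing R] [Algebra k R]

/-- For functions `x` on an affine scheme `Spec R` over `k` and an `L`-valued point of it, the
coordinate vectors of the tangent vectors at this point; a tangent vector is encoded as a
`k`-derivation `R → L`. If the `x j` generate `R`, this is the embedded tangent space. -/
def tangentSpace (k L : Type*) [CommRing k] [Algebra k R] [CommRing L] [Algebra k L] [Algebra R L]
    (x : ι → R) : Submodule L (ι → L) :=
  LinearMap.range (
    { toFun := fun δ j => δ (x j)
      map_add' := fun _ _ => rfl
      map_smul' := fun _ _ => rfl } : Derivation k R L →ₗ[L] ι → L)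

theorem mem_tangentSpace_iff {L : Type*} [CommRing L] [Algebra k L] [Algebra R L] {x : ι → R}
    {v : ι → L} : v ∈ tangentSpace k L x ↔ ∃ δ : Derivation k R L, ∀ j, δ (x j) = v j :=
  exists_congr fun _ => funext_iff

theorem derivation_ext_of_isFractionRing {K : Type*} [Field K] [Algebra k K] [Algebra R K]
    [IsScalarTower k R K] [IsFractionRing R K] {x : ι → R}
    (hx : Algebra.adjoin k (Set.range x) = ⊤) {δ δ' : Derivation k K K}
    (h : ∀ j, δ (algebraMap R K (x j)) = δ' (algebraMap R K (x j))) : δ = δ' := by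
  have hR : δ.compAlgebraMap R = δ'.compAlgebraMap R :=
    Derivation.ext_of_adjoin_eq_top _ hx (by rintro _ ⟨j, rfl⟩; exact h j)
  ext z
  obtain ⟨a, b, -, rfl⟩ := IsFractionRing.div_surjective (A := R) z
  have ha : δ (algebraMap R K a) = δ' (algebraMap R K a) := DFunLike.congr_fun hR a
  have hb : δ (algebraMap R K b) = δ' (algebraMap R K b) := DFunLike.congr_fun hR b
  rw [Derivation.leibniz_div, Derivation.leibniz_div, ha, hb]

theorem le_finrank_tangentSpace {k K : Type*} [Field k] [Algebra k R] [IsDomain R]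
    [Field K] [Algebra k K] [Algebra R K] [IsScalarTower k R K] [IsFractionRing R K] [Finite ι]
    {x : ι → R} (hx : Algebra.adjoin k (Set.range x) = ⊤) {d : ℕ}
    (hd : (d : WithBot ℕ∞) ≤ ringKrullDim R) : d ≤ Module.finrank K (tangentSpace k K x) := by
  have : Algebra.FiniteType k R := ⟨Set.finite_range x |>.toFinset, by simpa using hx⟩
  have : Algebra.EssFiniteType R K := .of_isLocalization _ (nonZeroDivisors R)
  have : Algebra.EssFiniteType k K := .comp k R K
  let f : Derivation k K K →ₗ[K] tangentSpace k K x :=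
    { toFun := fun δ => ⟨fun j => δ (algebraMap R K (x j)),
        mem_tangentSpace_iff.mpr ⟨δ.compAlgebraMap R, fun _ => rfl⟩⟩
      map_add' := fun _ _ => rfl
      map_smul' := fun _ _ => rfl }
  have hf : Function.Injective f := fun δ δ' h =>
    derivation_ext_of_isFractionRing hx fun j => congrFun (congrArg Subtype.val h) j
  have htrdeg := (natCast_le_trdeg_of_le_ringKrullDim k R K hd).trans
    (trdeg_le_rank_kaehlerDifferential k K)
  calc d ≤ Module.finrank K Ω[K⁄k] := by rwa [← Module.finrank_eq_rank, Nat.cast_le] at htrdeg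
    _ = Module.finrank K (Derivation k K K) := by
      rw [← (KaehlerDifferential.linearMapEquivDerivation k K).finrank_eq]
      exact Subspace.dual_finrank_eq.symm
    _ ≤ Module.finrank K (tangentSpace k K x) := LinearMap.finrank_le_finrank_of_injective hf

end TangentSpace

section Specialization

theorem exists_matrix_map_eq_smul {R K α β : Type*} [CommRing R] [Field K] [Algebra R K]
    [IsFractionRing R K] [Finite α] [Finite β] (B : Matrix α β K) :
    ∃ (r : R) (C : Matrix α β R), r ≠ 0 ∧ C.map (algebraMap R K) = algebraMap R K r • B := by
  have : Nontrivial R := (algebraMap R K).domain_nontrivial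
  obtain ⟨r, hr⟩ := IsLocalization.exist_integer_multiples_of_finite (nonZeroDivisors R)
    fun ij : α × β => B ij.1 ij.2
  choose C hC using hr
  refine ⟨r, .of fun i j => C (i, j), nonZeroDivisors.ne_zero r.2, ?_⟩
  ext i j
  exact (hC (i, j)).trans (Algebra.smul_def _ _)

theorem exists_integral_frame {R K ι : Type*} [CommRing R] [IsDomain R] [Field K] [Algebra R K]
    [IsFractionRing R K] [Fintype ι] (N : Submodule K (ι → K)) :
    ∃ (c : Matrix ι (Fin (Module.finrank K N)) R) (c' : Matrix (Fin (Module.finrank K N)) ι R)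
      (g : R), g ≠ 0 ∧ c' * c = g • 1 ∧ ∀ v, (c.map (algebraMap R K)).mulVec v ∈ N := by
  classical
  let f : (Fin (Module.finrank K N) → K) →ₗ[K] ι → K :=
    N.subtype ∘ₗ (Module.finBasis K N).equivFun.symm.toLinearMap
  have hf : LinearMap.ker f = ⊥ := LinearMap.ker_eq_bot.mpr
    (N.injective_subtype.comp (Module.finBasis K N).equivFun.symm.injective)
  obtain ⟨f', hf'⟩ := f.exists_leftInverse_of_injective hf
  obtain ⟨r, c, hr, hc⟩ := exists_matrix_map_eq_smul (R := R) (LinearMap.toMatrix' f)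
  obtain ⟨r', c', hr', hc'⟩ := exists_matrix_map_eq_smul (R := R) (LinearMap.toMatrix' f')
  refine ⟨c, c', r' * r, mul_ne_zero hr' hr, ?_, fun v => ?_⟩
  · refine Matrix.map_injective (IsFractionRing.injective R K) ?_
    change (c' * c).map _ = ((r' * r) • (1 : Matrix _ _ R)).map _
    rw [Matrix.map_mul, hc, hc', Matrix.smul_mul, Matrix.mul_smul, ← LinearMap.toMatrix'_comp, hf',
      LinearMap.toMatrix'_id, smul_smul, ← map_mul]
    ext i j
    simp [Matrix.one_apply, apply_ite (algebraMap R K)]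
  · rw [hc, Matrix.smul_mulVec, LinearMap.toMatrix'_mulVec]
    exact N.smul_mem _ (Subtype.coe_prop _)

theorem mulVec_surjective_of_specialization {R S K κ : Type*} [CommRing R] [CommRing S]
    [Nontrivial S] [Field K] [Algebra R K] [FaithfulSMul R K] [Fintype κ] {m : ℕ}
    {M : Matrix (Fin m) κ R} (f : R →+* S) (hf : Function.Surjective f)
    (h : Function.Surjective (M.map f).mulVec) :
    Function.Surjective (M.map (algebraMap R K)).mulVec := by
  obtain ⟨D, hD⟩ := Matrix.mulVec_surjective_iff_exists_right_inverse.mp h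
  let C : Matrix κ (Fin m) R := D.map (Function.surjInv hf)
  have hC : C.map f = D := by ext; simp [C, Function.surjInv_eq hf]
  have hdet : (M * C).det ≠ 0 := fun h0 => by
    have := congrArg f h0
    rw [RingHom.map_det, RingHom.mapMatrix_apply, Matrix.map_mul, hC, hD, Matrix.det_one,
      map_zero] at this
    exact one_ne_zero this
  have hunit : IsUnit ((M.map (algebraMap R K)) * C.map (algebraMap R K)) := by
    rw [← Matrix.map_mul, Matrix.isUnit_iff_isUnit_det, isUnit_iff_ne_zero,
      ← RingHom.mapMatrix_apply, ← RingHom.map_det]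
    exact (map_ne_zero_iff _ (FaithfulSMul.algebraMap_injective R K)).mpr hdet
  intro y
  obtain ⟨v, hv⟩ := Matrix.mulVec_surjective_iff_isUnit.mpr hunit y
  exact ⟨_, (Matrix.mulVec_mulVec _ _ _).trans hv⟩

/- `W` is the specialization of `N` at a rational point where a frame of `N` stays independent;
surjectivity is an open condition, so it passes from the special point to the generic one. -/
theorem HasDenseRationalPoints.exists_submodule_forall_map_eq_top {k R K ι : Type*} [Field k]
    [CommRing R] [IsDomain R] [Algebra k R] (hR : HasDenseRationalPoints k R) [Field K]
    [Algebra k K] [Algebra R K] [IsScalarTower k R K] [IsFractionRing R K] [Fintype ι]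
    (N : Submodule K (ι → K)) :
    ∃ W : Submodule k (ι → k), Module.finrank k W = Module.finrank K N ∧
      ∀ {m : ℕ} (A : Matrix (Fin m) ι k), W.map A.mulVecLin = ⊤ →
        N.map (A.map (algebraMap k K)).mulVecLin = ⊤ := by
  obtain ⟨c, c', g, hg, hc, hN⟩ := exists_integral_frame (R := R) N
  obtain ⟨ev, hev⟩ := hR g hg
  let W := LinearMap.range (c.map ev).mulVecLin
  have hinj : Function.Injective (c.map ev).mulVecLin := by
    have hmul : c'.map ev * c.map ev = ev g • 1 := by
      rw [← Matrix.map_mul, hc]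
      ext i j
      simp [Matrix.one_apply, apply_ite ev]
    intro v w hvw
    have := congrArg (c'.map ev).mulVec hvw
    simpa [Matrix.mulVec_mulVec, hmul, Matrix.smul_mulVec, hev] using this
  refine ⟨W, ?_, fun {m} A hA => ?_⟩
  · rw [LinearMap.finrank_range_of_inj hinj, Module.finrank_fin_fun]
  · rw [← LinearMap.range_comp, ← Matrix.mulVecLin_mul, LinearMap.range_eq_top,
      Matrix.coe_mulVecLin] at hA
    have hspecialize : A * c.map ev = (A.map (algebraMap k R) * c).map (ev : R →+* k) := by
      rw [Matrix.map_mul, Matrix.map_map]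
      congr
      ext; simp
    rw [hspecialize] at hA
    have hK := mulVec_surjective_of_specialization (K := K) _
      (fun a => ⟨algebraMap k R a, ev.commutes a⟩) hA
    refine Submodule.eq_top_iff'.mpr fun y => ?_
    obtain ⟨v, rfl⟩ := hK y
    refine ⟨_, hN v, ?_⟩
    rw [Matrix.mulVecLin_apply, Matrix.mulVec_mulVec, Matrix.map_mul, Matrix.map_map,
      ← RingHom.coe_comp, ← IsScalarTower.algebraMap_eq]

end Specialization

section Varieties

theorem HasDenseRationalPoints.exists_submodule_forall_algebraicIndependent {k R ι : Type*}
    [Field k] [CommRing R] [IsDomain R] [Algebra k R] (hR : HasDenseRationalPoints k R)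
    [Fintype ι] {x : ι → R} (hx : Algebra.adjoin k (Set.range x) = ⊤) {d : ℕ}
    (hd : (d : WithBot ℕ∞) ≤ ringKrullDim R) :
    ∃ W : Submodule k (ι → k), d ≤ Module.finrank k W ∧
      ∀ {m : ℕ} (A : Matrix (Fin m) ι k), W.map A.mulVecLin = ⊤ →
        AlgebraicIndependent k fun i => ∑ j, A i j • x j := by
  let K := FractionRing R
  obtain ⟨W, hW, hmap⟩ := hR.exists_submodule_forall_map_eq_top (tangentSpace k K x)
  refine ⟨W, hW ▸ le_finrank_tangentSpace hx hd, fun A hA =>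
    hR.algebraicIndependent (L := K) fun w => ?_⟩
  obtain ⟨v, hv, rfl⟩ := (hmap A hA).ge (Submodule.mem_top (x := w))
  obtain ⟨δ, hδ⟩ := mem_tangentSpace_iff.mp hv
  refine ⟨δ, fun i => ?_⟩
  rw [map_sum]
  refine Finset.sum_congr rfl fun j _ => ?_
  rw [Derivation.map_smul, hδ, Algebra.smul_def]
  rfl

variable {F : Type*} [Field F] {n m : ℕ}

theorem hasDenseRationalPoints_coordinateRing (V : Set (Fin n → F)) :
    HasDenseRationalPoints F (MvPolynomial (Fin n) F ⧸ vanishingIdeal F V) := by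
  intro r hr
  obtain ⟨f, rfl⟩ := Ideal.Quotient.mk_surjective r
  obtain ⟨x, hx, hfx⟩ : ∃ x ∈ V, aeval x f ≠ 0 := by
    by_contra! h
    exact hr (Ideal.Quotient.eq_zero_iff_mem.mpr h)
  exact ⟨Ideal.Quotient.liftₐ _ (aeval x) fun g hg => hg x hx, hfx⟩

theorem IsIrreducibleVariety.exists_submodule_forall_isDominantOn [Infinite F]
    {Z : Set (Fin n → F)} (hZ : IsIrreducibleVariety Z) {k : ℕ}
    (hk : (k : WithBot ℕ∞) ≤ dimension Z) :
    ∃ W : Submodule F (Fin n → F), k ≤ Module.finrank F W ∧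
      ∀ {m : ℕ} {φ : PolyMap F n m}, φ.IsLinear → IsDominantOn φ W → IsDominantOn φ Z := by
  have := hZ.isPrime_vanishingIdeal
  let x (j : Fin n) := Ideal.Quotient.mk (vanishingIdeal F Z) (X j)
  have hx : Algebra.adjoin F (Set.range x) = ⊤ := by
    have hrange : Set.range x = Ideal.Quotient.mkₐ F (vanishingIdeal F Z) '' Set.range X :=
      Set.range_comp _ _
    rw [hrange, ← AlgHom.map_adjoin, adjoin_range_X, Algebra.map_top, AlgHom.range_eq_top]
    exact Ideal.Quotient.mk_surjective
  obtain ⟨W, hW, hind⟩ := (hasDenseRationalPoints_coordinateRing Z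
    ).exists_submodule_forall_algebraicIndependent hx (hk.trans (dimension_le_ringKrullDim Z))
  refine ⟨W, hW, fun hφ hφW => ?_⟩
  obtain ⟨A, rfl⟩ := hφ.exists_eq_toMvPolynomial
  rw [isDominantOn_iff_algebraicIndependent]
  convert hind A (isDominantOn_toMvPolynomial_iff.mp hφW) with i
  rw [Matrix.toMvPolynomial, map_sum]
  refine Finset.sum_congr rfl fun j _ => ?_
  rw [← C_mul_X_eq_monomial, ← smul_eq_C_mul]
  rfl

theorem isLinearSeededRankExtractorForVarieties_of_subspaces [Infinite F] {k ℓ : ℕ} {ε : ℝ}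
    {φ : Fin ℓ → PolyMap F n m} (h : IsLinearSeededRankExtractorForSubspaces n m k ε φ) :
    IsLinearSeededRankExtractorForVarieties n m k ε φ := by
  obtain ⟨hlin, hmn, hsub⟩ := h
  refine ⟨hlin, hmn, fun V _ hk => ?_⟩
  obtain ⟨Z, hZ, hZV, hkZ⟩ := exists_irreducible_le_dimension hk
  obtain ⟨W, hW, hdom⟩ := hZ.exists_submodule_forall_isDominantOn hkZ
  refine (Nat.cast_le.mpr (Set.ncard_le_ncard ?_)).trans (hsub W hW)
  refine fun i hi hiW => hi ?_
  rw [hasFullRankOn_iff_isDominantOn] at hiW ⊢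
  exact (hdom (hlin i) hiW).mono hZV

end Varieties

section Pivots

variable {F ι : Type*} [Field F] [Finite ι] [LinearOrder ι] {m : ℕ}

theorem exists_pivots {W : Submodule F (ι → F)} (hW : m ≤ Module.finrank F W) :
    ∃ (p : Fin m → ι) (b : Fin m → ι → F), Function.Injective p ∧
      ∀ i, b i ∈ W ∧ b i (p i) ≠ 0 ∧ ∀ j, p i < j → b i j = 0 := by
  let IsPivot (j : ι) (w : ι → F) : Prop := w ∈ W ∧ w j ≠ 0 ∧ ∀ j', j < j' → w j' = 0
  let S : Set ι := {j | ∃ w, IsPivot j w}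
  let r : W →ₗ[F] S → F := LinearMap.funLeft F F Subtype.val ∘ₗ W.subtype
  have hr : Function.Injective r := by
    refine (injective_iff_map_eq_zero r).mpr fun w hw => ?_
    by_contra hne
    have hsupport : {j | (w : ι → F) j ≠ 0}.Nonempty := by
      obtain ⟨j, hj⟩ := Function.ne_iff.mp fun h0 => hne (Subtype.ext h0)
      exact ⟨j, hj⟩
    obtain ⟨j, hj, hmax⟩ := Set.exists_max_image _ id (Set.toFinite _) hsupport
    have hjw : IsPivot j w :=
      ⟨w.2, hj, fun j' hjj' => by_contra fun h => (hmax j' h).not_gt hjj'⟩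
    exact hj (congrFun hw ⟨j, w, hjw⟩)
  have hcard : m ≤ Nat.card S := by
    have := Fintype.ofFinite S
    rw [Nat.card_eq_fintype_card, ← Module.finrank_fintype_fun_eq_card F]
    exact hW.trans (LinearMap.finrank_le_finrank_of_injective hr)
  let p : Fin m → S := (Finite.equivFin S).symm ∘ Fin.castLE hcard
  choose b hb using fun i => (p i).2
  refine ⟨fun i => p i, b, ?_, hb⟩
  exact Subtype.val_injective.comp
    ((Finite.equivFin S).symm.injective.comp (Fin.castLE_injective hcard))

end Pivots

section SeedPolynomial

theorem sum_le_sum_add_card_mul {s t : Finset ℤ} {a b : ℤ} (hs : ∀ x ∈ s, x ≤ b)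
    (ht : ∀ x ∈ t, a ≤ x) (hst : s.card = t.card) :
    ∑ x ∈ s, x ≤ ∑ x ∈ t, x + s.card * (b + 1 - a - s.card) := by
  have hgauss : (∑ i ∈ Finset.range s.card, (i : ℤ)) * 2 = s.card * (s.card - 1) := by
    rw [← Nat.cast_sum, ← Nat.cast_two, ← Nat.cast_mul, Finset.sum_range_id_mul_two]
    rcases s.card with _ | r <;> simp
  have hle := Finset.sum_le_sum_range hs
  have hge := Finset.sum_range_le_sum ht
  rw [← hst] at hge
  simp only [Finset.sum_sub_distrib, Finset.sum_add_distrib, Finset.sum_const, Finset.card_range,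
    nsmul_eq_mul] at hle hge
  linarith

theorem sum_le_sum_add_of_injective {m n : ℕ} {σ τ : Fin m → Fin n}
    (hσ : Function.Injective σ) (hτ : Function.Injective τ) :
    ∑ i, (σ i : ℕ) ≤ ∑ i, (τ i : ℕ) + m * (n - m) := by
  have hmn : m ≤ n := by simpa using Fintype.card_le_of_injective σ hσ
  let e (ρ : Fin m → Fin n) (i : Fin m) : ℤ := (ρ i : ℕ)
  have he {ρ : Fin m → Fin n} (hρ : Function.Injective ρ) : Function.Injective (e ρ) :=
    fun i j hij => hρ (Fin.ext (Nat.cast_injective hij))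
  have hcard {ρ : Fin m → Fin n} (hρ : Function.Injective ρ) :
      (Finset.univ.image (e ρ)).card = m := by
    rw [Finset.card_image_of_injective _ (he hρ), Finset.card_fin]
  have h := sum_le_sum_add_card_mul (s := Finset.univ.image (e σ)) (t := Finset.univ.image (e τ))
    (a := 0) (b := n - 1) (by simp [e]) (by simp [e]) ((hcard hσ).trans (hcard hτ).symm)
  rw [Finset.sum_image (he hσ).injOn, Finset.sum_image (he hτ).injOn, hcard hσ, sub_add_cancel,
    sub_zero] at h
  zify [hmn]
  exact h

theorem card_add_natTrailingDegree_le_natDegree {R : Type*} [CommRing R] [IsDomain R]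
    {P : Polynomial R} (hP : P ≠ 0) {S : Finset R} (hS : ∀ x ∈ S, x ≠ 0 ∧ P.IsRoot x) :
    S.card + P.natTrailingDegree ≤ P.natDegree := by
  let _ := Classical.decEq R
  have hS_le : S.val ≤ P.roots.filter (· ≠ 0) := by
    refine (Multiset.le_iff_subset S.nodup).mpr fun x hx => ?_
    exact Multiset.mem_filter.mpr ⟨(Polynomial.mem_roots hP).mpr (hS x hx).2, (hS x hx).1⟩
  calc S.card + P.natTrailingDegree
      ≤ (P.roots.filter (· ≠ 0)).card + (P.roots.filter (· = 0)).card := by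
        rw [Multiset.filter_eq', Multiset.card_replicate, Polynomial.count_roots,
          Polynomial.rootMultiplicity_eq_natTrailingDegree']
        exact Nat.add_le_add_right (Multiset.card_le_card hS_le) _
    _ = P.roots.card := by
      rw [← Multiset.card_add, add_comm, Multiset.filter_add_not]
    _ ≤ P.natDegree := P.card_roots'

variable {R : Type*} [CommRing R] {n m : ℕ}

/-- The matrix of the Forbes–Shpilka map, over an arbitrary ring so that the seed can be taken to be
an indeterminate. -/
def forbesShpilkaMatrix (n m : ℕ) (ω s : R) : Matrix (Fin m) (Fin n) R :=
  .of fun j' j => (ω ^ (j' : ℕ) * s) ^ (j : ℕ)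

theorem forbesShpilkaMatrix_map {S : Type*} [CommRing S] (f : R →+* S) (ω s : R) :
    (forbesShpilkaMatrix n m ω s).map f = forbesShpilkaMatrix n m (f ω) (f s) := by
  ext
  simp [forbesShpilkaMatrix]

/-- The determinant of the Forbes–Shpilka map on the rows of `b`, as a polynomial in the seed. -/
def seedPolynomial (ω : R) (b : Matrix (Fin m) (Fin n) R) : Polynomial R :=
  (b.map Polynomial.C * (forbesShpilkaMatrix n m (Polynomial.C ω) Polynomial.X).transpose).det

theorem eval_seedPolynomial (ω s : R) (b : Matrix (Fin m) (Fin n) R) :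
    (seedPolynomial ω b).eval s = (b * (forbesShpilkaMatrix n m ω s).transpose).det := by
  rw [seedPolynomial, ← Polynomial.coe_evalRingHom, RingHom.map_det, RingHom.mapMatrix_apply,
    Matrix.map_mul, Matrix.transpose_map, forbesShpilkaMatrix_map]
  simp [Matrix.map_map, Function.comp_def]

theorem seedPolynomial_eq_sum (ω : R) (b : Matrix (Fin m) (Fin n) R) :
    seedPolynomial ω b = ∑ σ : Fin m → Fin n,
      Polynomial.monomial (∑ i, (σ i : ℕ))
        ((∏ i, b i (σ i)) * (Matrix.vandermonde fun i => ω ^ (σ i : ℕ)).det) := by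
  let column (j : Fin n) : Fin m → Polynomial R :=
    fun j' => (Polynomial.C ω ^ (j' : ℕ) * Polynomial.X) ^ (j : ℕ)
  have hrow : b.map Polynomial.C *
      (forbesShpilkaMatrix n m (Polynomial.C ω) Polynomial.X).transpose =
        .of fun i => ∑ j, Polynomial.C (b i j) • column j := by
    ext i j'
    simp [Matrix.mul_apply, forbesShpilkaMatrix, column]
  have hdet (σ : Fin m → Fin n) : (Matrix.of fun i => column (σ i)).det =
      Polynomial.X ^ (∑ i, (σ i : ℕ)) *
        Polynomial.C (Matrix.vandermonde fun i => ω ^ (σ i : ℕ)).det := by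
    rw [RingHom.map_det, ← Finset.prod_pow_eq_pow_sum, ← Matrix.det_mul_column]
    congr 1
    ext1 i j'
    simp only [column, Matrix.of_apply, Matrix.vandermonde_apply, RingHom.mapMatrix_apply,
      Matrix.map_apply, map_pow, mul_pow, ← pow_mul, mul_comm]
  have hexp := (Matrix.detRowAlternating (n := Fin m) (R := Polynomial R)).toMultilinearMap.map_sum
    fun i j => Polynomial.C (b i j) • column j
  simp only [MultilinearMap.map_smul_univ] at hexp
  rw [seedPolynomial, hrow]
  refine hexp.trans (Finset.sum_congr rfl fun σ _ => ?_)
  rw [← Polynomial.C_mul_X_pow_eq_monomial, map_mul, map_prod]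
  refine (congrArg _ (hdet σ)).trans ?_
  rw [smul_eq_mul]
  ring

theorem coeff_seedPolynomial (ω : R) (b : Matrix (Fin m) (Fin n) R) (d : ℕ) :
    (seedPolynomial ω b).coeff d = ∑ σ : Fin m → Fin n with ∑ i, (σ i : ℕ) = d,
      (∏ i, b i (σ i)) * (Matrix.vandermonde fun i => ω ^ (σ i : ℕ)).det := by
  simp only [seedPolynomial_eq_sum, Polynomial.finsetSum_coeff, Polynomial.coeff_monomial,
    Finset.sum_filter]

theorem exists_injective_of_coeff_seedPolynomial_ne_zero {ω : R} {b : Matrix (Fin m) (Fin n) R}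
    {d : ℕ} (h : (seedPolynomial ω b).coeff d ≠ 0) :
    ∃ σ : Fin m → Fin n, Function.Injective σ ∧ ∑ i, (σ i : ℕ) = d := by
  rw [coeff_seedPolynomial] at h
  obtain ⟨σ, hσ, hne⟩ := Finset.exists_ne_zero_of_sum_ne_zero h
  refine ⟨σ, fun i j hij => ?_, (Finset.mem_filter.mp hσ).2⟩
  by_contra hne'
  exact right_ne_zero_of_mul hne (Matrix.det_zero_of_row_eq hne' (by ext; simp [hij]))

theorem natDegree_seedPolynomial_le {ω : R} {b : Matrix (Fin m) (Fin n) R}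
    (h : seedPolynomial ω b ≠ 0) :
    (seedPolynomial ω b).natDegree ≤ (seedPolynomial ω b).natTrailingDegree + m * (n - m) := by
  obtain ⟨σ, hσ, hσsum⟩ := exists_injective_of_coeff_seedPolynomial_ne_zero
    (Polynomial.leadingCoeff_ne_zero.mpr h)
  obtain ⟨τ, hτ, hτsum⟩ := exists_injective_of_coeff_seedPolynomial_ne_zero
    (Polynomial.trailingCoeff_nonzero_iff_nonzero.mpr h)
  rw [← hσsum, ← hτsum]
  exact sum_le_sum_add_of_injective hσ hτ

theorem seedPolynomial_ne_zero [IsDomain R] {ω : R}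
    (hω : Function.Injective fun j : Fin n => ω ^ (j : ℕ))
    {p : Fin m → Fin n} {b : Matrix (Fin m) (Fin n) R} (hp : Function.Injective p)
    (hbp : ∀ i, b i (p i) ≠ 0) (hb : ∀ i j, p i < j → b i j = 0) : seedPolynomial ω b ≠ 0 := by
  have hcoeff : (seedPolynomial ω b).coeff (∑ i, (p i : ℕ)) =
      (∏ i, b i (p i)) * (Matrix.vandermonde fun i => ω ^ (p i : ℕ)).det := by
    rw [coeff_seedPolynomial]
    refine Finset.sum_eq_single_of_mem p (by simp) fun σ hσ hne => ?_
    obtain ⟨i, hi⟩ : ∃ i, p i < σ i := by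
      by_contra! hle
      have hsum := (Finset.sum_eq_sum_iff_of_le fun i _ => Fin.val_fin_le.mpr (hle i)).mp
        (Finset.mem_filter.mp hσ).2
      exact hne (funext fun i => Fin.ext (hsum i (Finset.mem_univ i)))
    rw [Finset.prod_eq_zero (Finset.mem_univ i) (hb i _ hi), zero_mul]
  intro h0
  rw [h0, Polynomial.coeff_zero, eq_comm] at hcoeff
  refine mul_ne_zero (Finset.prod_ne_zero_iff.mpr fun i _ => hbp i) ?_ hcoeff
  exact Matrix.det_vandermonde_ne_zero_iff.mpr (hω.comp hp)

end SeedPolynomial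

section ForbesShpilka

variable {F : Type*} [Field F] {n m : ℕ}

theorem forbesShpilkaMap_eq_toMvPolynomial (ω s : Fˣ) :
    forbesShpilkaMap n m ω s = (forbesShpilkaMatrix n m (ω : F) s).toMvPolynomial :=
  funext fun _ => Finset.sum_congr rfl fun _ _ => C_mul_X_eq_monomial

theorem forbesShpilkaMap_isLinear (ω s : Fˣ) : (forbesShpilkaMap n m ω s).IsLinear := by
  rw [forbesShpilkaMap_eq_toMvPolynomial]
  exact Matrix.toMvPolynomial_isHomogeneous _

theorem map_mulVecLin_eq_top_of_det_ne_zero {W : Submodule F (Fin n → F)}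
    {A b : Matrix (Fin m) (Fin n) F} (hb : ∀ i, b i ∈ W) (h : (b * A.transpose).det ≠ 0) :
    W.map A.mulVecLin = ⊤ := by
  refine Submodule.eq_top_iff'.mpr fun y => ?_
  obtain ⟨v, rfl⟩ := Matrix.vecMul_surjective_iff_isUnit.mpr
    ((Matrix.isUnit_iff_isUnit_det _).mpr h.isUnit) y
  refine ⟨Matrix.vecMul v b, ?_, ?_⟩
  · rw [Matrix.vecMul_eq_sum]
    exact W.sum_mem fun i _ => W.smul_mem _ (hb i)
  · rw [Matrix.mulVecLin_apply, ← Matrix.vecMul_transpose, Matrix.vecMul_vecMul]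

theorem card_le_of_map_forbesShpilkaMatrix_ne_top {ω : F}
    (hω : Function.Injective fun j : Fin n => ω ^ (j : ℕ)) {W : Submodule F (Fin n → F)}
    (hW : m ≤ Module.finrank F W) {S : Finset F}
    (hS : ∀ s ∈ S, s ≠ 0 ∧ W.map (forbesShpilkaMatrix n m ω s).mulVecLin ≠ ⊤) :
    S.card ≤ m * (n - m) := by
  obtain ⟨p, b, hp, hb⟩ := exists_pivots hW
  have hP := seedPolynomial_ne_zero (b := .of b) hω hp (fun i => (hb i).2.1) fun i => (hb i).2.2
  have hroots : ∀ s ∈ S, s ≠ 0 ∧ (seedPolynomial ω (.of b)).IsRoot s := fun s hs => by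
    refine ⟨(hS s hs).1, ?_⟩
    rw [Polynomial.IsRoot, eval_seedPolynomial]
    by_contra hdet
    exact (hS s hs).2 (map_mulVecLin_eq_top_of_det_ne_zero (fun i => (hb i).1) hdet)
  have hcard := card_add_natTrailingDegree_le_natDegree hP hroots
  have hdegree := natDegree_seedPolynomial_le hP
  lia

theorem pow_injective_of_not_isOfFinOrder_or_le_orderOf {G : Type*} [Group G] {ω : G}
    (h : ¬ IsOfFinOrder ω ∨ n ≤ orderOf ω) : Function.Injective fun j : Fin n => ω ^ (j : ℕ) := by
  intro i j hij
  refine Fin.ext ?_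
  rcases h with h | h
  · exact injective_pow_iff_not_isOfFinOrder.mpr h hij
  · exact pow_injOn_Iio_orderOf (i.2.trans_le h) (j.2.trans_le h) hij

theorem forbesShpilkaMap_isLinearSeededRankExtractorForSubspaces [Infinite F] {ℓ : ℕ} {ω : Fˣ}
    {s : Fin ℓ → Fˣ} (hmn : m ≤ n) (hω : Function.Injective fun j : Fin n => ω ^ (j : ℕ))
    (hs : Function.Injective s) :
    IsLinearSeededRankExtractorForSubspaces n m m ((m : ℝ) * ((n : ℝ) - (m : ℝ)) / (ℓ : ℝ))
      (fun i => forbesShpilkaMap n m ω (s i)) := by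
  refine ⟨fun i => forbesShpilkaMap_isLinear ω (s i), hmn, fun W hW => ?_⟩
  rcases Nat.eq_zero_or_pos ℓ with rfl | hℓ
  · simp [Set.eq_empty_of_isEmpty]
  rw [div_mul_cancel₀ _ (by positivity), ← Nat.cast_sub hmn, ← Nat.cast_mul, Nat.cast_le]
  let I : Set (Fin ℓ) := {i | ¬ HasFullRankOn (forbesShpilkaMap n m ω (s i)) (W : Set (Fin n → F))}
  have hsF : Function.Injective fun i => (s i : F) := Units.val_injective.comp hs
  have hωF : Function.Injective fun j : Fin n => (ω : F) ^ (j : ℕ) := fun i j hij =>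
    hω (Units.ext (by simpa using hij))
  change I.ncard ≤ _
  rw [← Set.ncard_image_of_injective I hsF, Set.ncard_eq_toFinset_card _]
  refine card_le_of_map_forbesShpilkaMatrix_ne_top hωF hW fun x hx => ?_
  obtain ⟨i, hi, rfl⟩ := (Set.Finite.mem_toFinset _).mp hx
  refine ⟨(s i).ne_zero, fun htop => hi ?_⟩
  rwa [hasFullRankOn_iff_isDominantOn, forbesShpilkaMap_eq_toMvPolynomial,
    isDominantOn_toMvPolynomial_iff]

end ForbesShpilka

end

end RankExtractor

theorem mainTheorem6_general {F : Type*} [Field F] [Infinite F] :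
    (∀ (n m k ℓ : ℕ) (ε : ℝ) (φ : Fin ℓ → RankExtractor.PolyMap F n m),
      RankExtractor.IsLinearSeededRankExtractorForSubspaces n m k ε φ →
        RankExtractor.IsLinearSeededRankExtractorForVarieties n m k ε φ) ∧
    (∀ (n m : ℕ) (φ : RankExtractor.PolyMap F n m) (V : Set (Fin n → F)),
      RankExtractor.HasFullRankOn φ V ↔ RankExtractor.IsDominantOn φ V) ∧
    (∀ (n m ℓ : ℕ) (ω : Fˣ) (s : Fin ℓ → Fˣ), m ≤ n →
      (¬ IsOfFinOrder ω ∨ n ≤ orderOf ω) → Function.Injective s →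
        RankExtractor.IsLinearSeededRankExtractorForVarieties n m m
          ((m : ℝ) * ((n : ℝ) - (m : ℝ)) / (ℓ : ℝ))
          (fun i => RankExtractor.forbesShpilkaMap n m ω (s i))) := by
  refine ⟨fun n m k ℓ ε φ h => ?_, fun n m φ V => ?_, fun n m ℓ ω s hmn hω hs => ?_⟩
  · exact RankExtractor.isLinearSeededRankExtractorForVarieties_of_subspaces h
  · exact RankExtractor.hasFullRankOn_iff_isDominantOn
  · exact RankExtractor.isLinearSeededRankExtractorForVarieties_of_subspaces
      (RankExtractor.forbesShpilkaMap_isLinearSeededRankExtractorForSubspaces hmn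
        (RankExtractor.pow_injective_of_not_isOfFinOrder_or_le_orderOf hω) hs)

theorem mainTheorem6 {F : Type*} [Field F] [IsAlgClosed F] :
    -- linear seeded rank extractors for subspaces are such extractors for varieties
    (∀ (n m k ℓ : ℕ) (ε : ℝ) (φ : Fin ℓ → RankExtractor.PolyMap F n m),
      RankExtractor.IsLinearSeededRankExtractorForSubspaces n m k ε φ →
        RankExtractor.IsLinearSeededRankExtractorForVarieties n m k ε φ) ∧
    -- full rank on a variety is the same as dominance
    (∀ (n m : ℕ) (φ : RankExtractor.PolyMap F n m) (V : Set (Fin n → F)),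
      RankExtractor.IsAffineVariety V →
        (RankExtractor.HasFullRankOn φ V ↔ RankExtractor.IsDominantOn φ V)) ∧
    -- the Forbes–Shpilka construction; the order of `ω` is infinite or at least `n`
    (∀ (n m ℓ : ℕ) (ω : Fˣ) (s : Fin ℓ → Fˣ), 1 ≤ m → m ≤ n →
      (¬ IsOfFinOrder ω ∨ n ≤ orderOf ω) → Function.Injective s →
        RankExtractor.IsLinearSeededRankExtractorForVarieties n m m
          ((m : ℝ) * ((n : ℝ) - (m : ℝ)) / (ℓ : ℝ))
          (fun i => RankExtractor.forbesShpilkaMap n m ω (s i))) := by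
  obtain ⟨hsubspaces, hdominant, hforbesShpilka⟩ := mainTheorem6_general (F := F)
  exact ⟨hsubspaces, fun n m φ V _ => hdominant n m φ V,
    fun n m ℓ ω s _ => hforbesShpilka n m ℓ ω s⟩
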